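/- There are universal constants $c,c_0,C>0$ such that the following holds for every integer $n>1$, all reals $\mu>\lambda>0$ and every $\epsilon\in(0,c)$. There is a dimension $$d\;\le\; n^{\,C\left(1+\sqrt{\frac{\mu}{\lambda n}}\,\log\frac n\epsilon\right)}$$ (that is, $d=n^{\tilde O(1+\sqrt{\mu/(\lambda n)})}$), depending only on $n,\mu,\lambda,\epsilon$, such that for every (possibly randomized) algorithm on $\mathbb R^d$ that satisfies the linear-algebraic assumption below there exist $\mu$-smooth and $\lambda$-strongly convex quadratic functions $f_1,\dots,f_n:\mathbb R^d\to\mathbb R$ (i.e. $\lambda I\preceq\nabla^2 f_i\preceq\mu I$) for which, with $F=\frac1n\sum_{i=1}^n f_i$, with probability $1$ over the randomness of the algorithm, every $T\ge1$ with $$F(\mathbf w_T)-\min_{\mathbf w}F(\mathbf w)\;\le\;\epsilon\left(F(\mathbf 0)-\min_{\mathbf w}F(\mathbf w)\right)$$ satisfies $$T\;\ge\; c_0\left(n+\sqrt{n\left(\tfrac{\mu}{\lambda}-1\right)}\,\log\frac{(\lambda/\mu)^{3/2}\sqrt n}{\epsilon}\right).$$ Here the algorithm sequentially queries a second-order oracle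 with pairs $(\mathbf w_t,i_t)\in\mathbb R^d\times\{1,\dots,n\}$, $t=1,2,\dots$, and receives $f_{i_t}(\mathbf w_t),\nabla f_{i_t}(\mathbf w_t),\nabla^2 f_{i_t}(\mathbf w_t)$. Both $\mathbf w_t$ and $i_t$ may depend arbitrarily on the algorithm's random seed and on all previous answers; in particular the indices may be chosen adaptively. Linear-algebraic assumption: whenever the algorithm is run on $n$ $\mu$-smooth and $\lambda$-strongly convex quadratics on $\mathbb R^d$, almost surely $\mathbf w_t\in\mathcal W_t$ for all $t$, where $\mathcal W_1=\{\mathbf 0\}$ and $\mathcal W_{t+1}$ is the closure of the set of vectors derived from $\mathcal W_t\cup\{\nabla f_{i_t}(\mathbf w_t)\}$ by finitely many operations of the form (i) $\mathbf w,\mathbf w'\mapsto\alpha\mathbf w+\alpha'\mathbf w'$ with arbitrary real $\alpha,\alpha'$, and (ii) $\mathbf w\mapsto H\mathbf w$, where $H$ is any $d\times d$ matrix with the same block-diagonal structure as $M=\sum_{\tau=\max\{1,t-\lfloor n/2\rfloor+1\}}^{t}\alpha_\tau\nabla^2 f_{i_\tau}(\mathbf w_\tau)$ for some reals $\alpha_\tau$;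 this means that whenever $M$ decomposes into consecutive diagonal blocks of sizes $d_1,\dots,d_r$ (in order), so does $H$. -/

import Mathlib

open scoped Gradient

noncomputable section

namespace SecondOrder

/-- The Euclidean space `ℝᵈ`. -/
abbrev E (d : ℕ) : Type := EuclideanSpace ℝ (Fin d)

/-- The `d × d` matrix of second derivatives of `f` at `w`: the entry `(r, s)` is the `r`-th
coordinate of the derivative of the gradient in the direction of the `s`-th unit vector. -/
def hessian {d : ℕ} (f : E d → ℝ) (w : E d) : Matrix (Fin d) (Fin d) ℝ :=
  Matrix.of fun r s => (fderiv ℝ (fun v => gradient f v) w (EuclideanSpace.single s (1 : ℝ))) r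

/-- `f` is a quadratic function `w ↦ ½ wᵀ A w + bᵀ w + c`. -/
def IsQuadratic {d : ℕ} (f : E d → ℝ) : Prop :=
  ∃ (A : Matrix (Fin d) (Fin d) ℝ) (b : E d) (c : ℝ), ∀ w : E d,
    f w = (1 / 2) * inner ℝ w (Matrix.toEuclideanLin A w) + inner ℝ b w + c

/-- A twice differentiable function is `mu`-smooth and `lam`-strongly convex if
`lam • I ≼ ∇² f(w) ≼ mu • I` for all `w`. -/
def SmoothStronglyConvex {d : ℕ} (mu lam : ℝ) (f : E d → ℝ) : Prop :=
  ContDiff ℝ 2 f ∧ ∀ w : E d,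
    (hessian f w - lam • (1 : Matrix (Fin d) (Fin d) ℝ)).PosSemidef ∧
    (mu • (1 : Matrix (Fin d) (Fin d) ℝ) - hessian f w).PosSemidef

/-- The finite-sum problems under consideration: `n` individual functions on `ℝᵈ`, each of them a
`mu`-smooth and `lam`-strongly convex quadratic. -/
def IsInstance {n d : ℕ} (mu lam : ℝ) (f : Fin n → E d → ℝ) : Prop :=
  ∀ i, IsQuadratic (f i) ∧ SmoothStronglyConvex mu lam (f i)

/-- The objective `F = (1/n) ∑ᵢ fᵢ` of a finite-sum problem. -/
def objective {n d : ℕ} (f : Fin n → E d → ℝ) (w : E d) : ℝ :=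
  (1 / (n : ℝ)) * ∑ i, f i w

/-! ### The second-order oracle and algorithms using it -/

/-- What the second-order oracle returns for one query. -/
structure Answer (d : ℕ) where
  value : ℝ
  grad : E d
  hess : Matrix (Fin d) (Fin d) ℝ

/-- The second-order oracle: it receives an index `i` and a point `w`. -/
def oracle {n d : ℕ} (f : Fin n → E d → ℝ) (i : Fin n) (w : E d) : Answer d where
  value := f i w
  grad := gradient (f i) w
  hess := hessian (f i) w

/-- A randomized algorithm with seed space `Ω`: from its seed and the list of the oracle's answers
so far (oldest first) it computes the next point and the next index to be queried. Both the point
and the index may depend on the answers in any way. A deterministic algorithm is one that ignores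
the seed. -/
abbrev Algorithm (Ω : Type*) (n d : ℕ) : Type _ := Ω → List (Answer d) → E d × Fin n

section Run

variable {Ω : Type*} {n d : ℕ}

/-- The answers received by the algorithm in its first `t` oracle calls. -/
def history (alg : Algorithm Ω n d) (f : Fin n → E d → ℝ) (ω : Ω) : ℕ → List (Answer d)
  | 0 => []
  | t + 1 => history alg f ω t ++
      [oracle f (alg ω (history alg f ω t)).2 (alg ω (history alg f ω t)).1]

/-- The point of query number `t`, where `t = 0, 1, 2, …`. -/
def point (alg : Algorithm Ω n d) (f : Fin n → E d → ℝ) (ω : Ω) (t : ℕ) : E d :=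
  (alg ω (history alg f ω t)).1

/-- The index of query number `t`, where `t = 0, 1, 2, …`. -/
def index (alg : Algorithm Ω n d) (f : Fin n → E d → ℝ) (ω : Ω) (t : ℕ) : Fin n :=
  (alg ω (history alg f ω t)).2

end Run

/-! ### Linear-algebraic computations -/

/-- `M` decomposes into diagonal blocks along a partition of the coordinates into consecutive
intervals; the partition is given by a monotone labelling `b`, whose fibres are the intervals. -/
def IsBlockDiagonal {d : ℕ} (b : Fin d → ℕ) (M : Matrix (Fin d) (Fin d) ℝ) : Prop :=
  ∀ r s, b r ≠ b s → M r s = 0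

/-- `H` has the same block-diagonal structure as `M`: whenever `M` decomposes into consecutive
diagonal blocks of certain sizes, so does `H` (whose blocks may decompose further). -/
def SameBlockStructure {d : ℕ} (M H : Matrix (Fin d) (Fin d) ℝ) : Prop :=
  ∀ b : Fin d → ℕ, Monotone b → IsBlockDiagonal b M → IsBlockDiagonal b H

/-- The vectors derived from `S` by finitely many linear combinations and multiplications by
matrices from `ops`. -/
inductive Derived {d : ℕ} (S : Set (E d)) (ops : Set (Matrix (Fin d) (Fin d) ℝ)) : E d → Prop
  | base {w : E d} : w ∈ S → Derived S ops w
  | comb (a a' : ℝ) {w w' : E d} :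
      Derived S ops w → Derived S ops w' → Derived S ops (a • w + a' • w')
  | mul {H : Matrix (Fin d) (Fin d) ℝ} {w : E d} :
      H ∈ ops → Derived S ops w → Derived S ops (Matrix.toEuclideanLin H w)

/-- The matrices that may be used after query number `t`: those with the same block-diagonal
structure as some linear combination of the last (at most) `⌊n/2⌋` Hessians returned by the
oracle, that is, of those with number `τ`, where `t - ⌊n/2⌋ + 1 ≤ τ ≤ t`. -/
def allowedMatrices {n d : ℕ} (f : Fin n → E d → ℝ) (w : ℕ → E d) (i : ℕ → Fin n) (t : ℕ) :
    Set (Matrix (Fin d) (Fin d) ℝ) :=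
  {H | ∃ a : ℕ → ℝ, SameBlockStructure
    (∑ τ ∈ (Finset.range (t + 1)).filter (fun τ => t + 1 ≤ τ + n / 2),
      a τ • hessian (f (i τ)) (w τ)) H}

/-- The set of points that linear-algebraic computations permit as query number `t` of a run with
queries `(w 0, i 0), (w 1, i 1), …`. -/
def permitted {n d : ℕ} (f : Fin n → E d → ℝ) (w : ℕ → E d) (i : ℕ → Fin n) : ℕ → Set (E d)
  | 0 => {0}
  | t + 1 => closure {v | Derived (permitted f w i t ∪ {gradient (f (i t)) (w t)})
      (allowedMatrices f w i t) v}

/-- The algorithm performs linear-algebraic computations only: on every finite-sum problem in the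
class, almost surely, each of its points lies in the set permitted at that time. There is no
restriction on how the indices are chosen. -/
def LinearAlgebraic {Ω : Type*} [MeasurableSpace Ω] {n d : ℕ} (P : MeasureTheory.Measure Ω)
    (mu lam : ℝ) (alg : Algorithm Ω n d) : Prop :=
  ∀ f : Fin n → E d → ℝ, IsInstance mu lam f →
    ∀ᵐ ω ∂P, ∀ t : ℕ, point alg f ω t ∈ permitted f (point alg f ω) (index alg f ω) t

end SecondOrder

end

/-!
The hard instance does not depend on the algorithm. For every sequence `j` of `k + 1` labels in
`Fin n` there is a chain of `k + 1` consecutive coordinates. The label of a link tells which of the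
`n` functions owns it: the function `j 0` owns the linear term that pulls the first coordinate away
from `0`, and the function `j l` owns the square `(w_{l-1} - w_l)²`. Summed over all functions every
chain contributes the same strongly convex quadratic to the objective, and its optimum is the
geometric sequence `1, q, …, q ^ k` (`chain_stationary`, `objective_eq`).

A combination of the last `⌊n / 2⌋` Hessians decomposes before every link whose label is not among
the last `⌊n / 2⌋` queried indices. Matrices with the same block structure then do not carry
information across this link, so in each chain the links have to be passed one after the other
(`apply_eq_zero_of_mem_permitted`). Since all label sequences occur, one may average over them: for
*any* sequence of queried indices, at least a quarter of the labels stay outside the window for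
the next `n / 4` steps. An exponential weight of the passing time therefore shrinks by a constant
factor with each link (`sum_timeWeight_nextTime_le`), and Markov's inequality shows that within
`n (k + 1) / 64` queries a sixteenth of the chains is not passed (`card_le_of_passTime`). The index
choices may thus be adaptive and random.

A chain that is not passed has last coordinate `0` instead of `q ^ k`. Strong convexity turns this
into a relative suboptimality of at least `(1 - q) q ^ (2 k) / 16` (`le_objective_sub`). With
`y² = (mu / lam - 1) / n` one has `q = exp (-2 arsinh (1 / y)) ≥ exp (-2 / y)`, so that a chain
length of the order of `1 + y log (1 / (16 ε (1 + y)))` is admissible (`exists_length`); it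
yields the bound, and `n ^ (k + 1)` chains of that length give the dimension.
-/

namespace SecondOrder

/-! ### Gradient and Hessian of a quadratic -/

section Quadratic
variable {d : ℕ}

/-- The quadratic function `w ↦ ½ wᵀ A w + bᵀ w`. -/
noncomputable def quadratic (A : Matrix (Fin d) (Fin d) ℝ) (b w : E d) : ℝ :=
  (1 / 2) * inner ℝ w (Matrix.toEuclideanLin A w) + inner ℝ b w

theorem isQuadratic_quadratic (A : Matrix (Fin d) (Fin d) ℝ) (b : E d) :
    IsQuadratic (quadratic A b) :=
  ⟨A, b, 0, fun w => by simp [quadratic]⟩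

theorem inner_toEuclideanLin_comm {A : Matrix (Fin d) (Fin d) ℝ} (hA : A.IsHermitian)
    (v w : E d) : inner ℝ v (Matrix.toEuclideanLin A w) = inner ℝ (Matrix.toEuclideanLin A v) w :=
  ((Matrix.isSymmetric_toEuclideanLin_iff.2 hA) v w).symm

theorem gradient_quadratic {A : Matrix (Fin d) (Fin d) ℝ} (hA : A.IsHermitian) (b w : E d) :
    gradient (quadratic A b) w = Matrix.toEuclideanLin A w + b := by
  apply HasGradientAt.gradient
  rw [hasGradientAt_iff_hasFDerivAt]
  have hL : HasFDerivAt (fun v => (Matrix.toEuclideanLin A).toContinuousLinearMap v)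
      (Matrix.toEuclideanLin A).toContinuousLinearMap w :=
    (Matrix.toEuclideanLin A).toContinuousLinearMap.hasFDerivAt
  have h1 := (((hasFDerivAt_id w).inner ℝ hL).const_mul (1 / 2)).add
    ((innerSL ℝ b).hasFDerivAt (x := w))
  refine h1.congr_fderiv ?_
  ext v
  simp only [one_div, LinearMap.coe_toContinuousLinearMap', id_eq, add_apply,
    FunLike.coe_smul, ContinuousLinearMap.coe_comp, Pi.smul_apply,
    Function.comp_apply, ContinuousLinearMap.prod_apply, ContinuousLinearMap.coe_id',
    fderivInnerCLM_apply, smul_eq_mul, innerSL_apply_apply, InnerProductSpace.toDual_apply_apply,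
    inner_add_left, real_inner_comm (Matrix.toEuclideanLin A w) v,
    inner_toEuclideanLin_comm hA w v]
  ring

theorem hessian_quadratic {A : Matrix (Fin d) (Fin d) ℝ} (hA : A.IsHermitian) (b w : E d) :
    hessian (quadratic A b) w = A := by
  have h : (fun v => gradient (quadratic A b) v) =
      fun v => (Matrix.toEuclideanLin A).toContinuousLinearMap v + b :=
    funext fun v => gradient_quadratic hA b v
  ext r s
  rw [hessian, h, fderiv_add_const, ContinuousLinearMap.fderiv]
  simp [Matrix.toLpLin_apply]

theorem contDiff_quadratic (A : Matrix (Fin d) (Fin d) ℝ) (b : E d) :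
    ContDiff ℝ 2 (quadratic A b) := by
  unfold quadratic
  have : ContDiff ℝ 2 fun v => Matrix.toEuclideanLin A v :=
    (Matrix.toEuclideanLin A).toContinuousLinearMap.contDiff
  exact (contDiff_const.mul (contDiff_id.inner ℝ this)).add (contDiff_const.inner ℝ contDiff_id)

/-- Bounds on the quadratic form of the Hessian give smoothness and strong convexity. -/
theorem smoothStronglyConvex_quadratic {A : Matrix (Fin d) (Fin d) ℝ} (hA : A.IsHermitian)
    (b : E d) {mu lam : ℝ}
    (hlam : ∀ x : Fin d → ℝ, lam * ∑ r, x r ^ 2 ≤ dotProduct x (A.mulVec x))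
    (hmu : ∀ x : Fin d → ℝ, dotProduct x (A.mulVec x) ≤ mu * ∑ r, x r ^ 2) :
    SmoothStronglyConvex mu lam (quadratic A b) := by
  have h1 : ∀ a : ℝ, (a • (1 : Matrix (Fin d) (Fin d) ℝ)).IsHermitian := fun a => by
    ext r s; simp [Matrix.one_apply, eq_comm]
  have h2 (a : ℝ) (x : Fin d → ℝ) :
      dotProduct x ((a • (1 : Matrix (Fin d) (Fin d) ℝ)).mulVec x) = a * ∑ r, x r ^ 2 := by
    simp [Matrix.smul_mulVec, dotProduct, pow_two, Finset.mul_sum, mul_left_comm]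
  refine ⟨contDiff_quadratic A b, fun w => ?_⟩
  rw [hessian_quadratic hA]
  constructor
  · refine Matrix.PosSemidef.of_dotProduct_mulVec_nonneg (hA.sub (h1 _)) fun x => ?_
    rw [Matrix.sub_mulVec, dotProduct_sub, star_trivial, h2]
    linarith [hlam x]
  · refine Matrix.PosSemidef.of_dotProduct_mulVec_nonneg ((h1 _).sub hA) fun x => ?_
    rw [Matrix.sub_mulVec, dotProduct_sub, star_trivial, h2]
    linarith [hmu x]

end Quadratic

/-! ### Passing times of label sequences -/
/-- The first time `t' ≥ t` at which `x ∈ S t'`; times after the horizon `T` count as never, and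
are all represented by the first of them that is at least `t`. -/
noncomputable def nextTime {α : Type*} (S : ℕ → Finset α) (T t : ℕ) (x : α) : ℕ :=
  sInf {t' | t ≤ t' ∧ (x ∈ S t' ∨ T < t')}

section NextTime
variable {α : Type*} (S : ℕ → Finset α) (T t : ℕ) (x : α)

theorem nextTime_spec : t ≤ nextTime S T t x ∧
    (x ∈ S (nextTime S T t x) ∨ T < nextTime S T t x) :=
  Nat.sInf_mem (s := {t' | t ≤ t' ∧ (x ∈ S t' ∨ T < t')})
    ⟨max t (T + 1), le_max_left _ _, Or.inr (by have := le_max_right t (T + 1); omega)⟩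

variable {S t x} in
theorem nextTime_le {t' : ℕ} (h : t ≤ t') (hx : x ∈ S t') : nextTime S T t x ≤ t' :=
  Nat.sInf_le ⟨h, Or.inl hx⟩

end NextTime

/-- The times at which the labels `j 0, j 1, …` have been met one after the other: `passTime l` is
the first time by which `j 0, …, j (l - 1)` can be found, in this order, in sets `S t` with
nondecreasing `t`, up to the horizon `T`. It stays constant for `l ≥ K`. -/
noncomputable def passTime {α : Type*} (S : ℕ → Finset α) (T : ℕ) {K : ℕ} (j : Fin K → α) : ℕ → ℕ
  | 0 => 0
  | l + 1 => if h : l < K then nextTime S T (passTime S T j l) (j ⟨l, h⟩) else passTime S T j l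

section PassTime
variable {α : Type*} (S : ℕ → Finset α) (T : ℕ) {K : ℕ}

theorem passTime_mono (j : Fin K → α) : Monotone (passTime S T j) := by
  refine monotone_nat_of_le_succ fun l => ?_
  rw [passTime]
  split_ifs with h
  · exact (nextTime_spec S T _ _).1
  · exact le_rfl

theorem passTime_succ_le (j : Fin K → α) {l : Fin K} {t : ℕ}
    (h : passTime S T j l ≤ t) (hl : j l ∈ S t) : passTime S T j (l + 1) ≤ t := by
  rw [passTime, dif_pos l.2]
  exact nextTime_le T h hl

theorem passTime_snoc (j : Fin K → α) (x : α) {l : ℕ} (hl : l ≤ K) :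
    passTime S T (Fin.snoc j x : Fin (K + 1) → α) l = passTime S T j l := by
  induction l with
  | zero => rfl
  | succ l ih =>
    have hl' : l < K := hl
    rw [passTime, passTime, dif_pos (by omega), dif_pos hl', ih hl'.le]
    congr 1
    exact Fin.snoc_castSucc (α := fun _ => α) x j ⟨l, hl'⟩

theorem passTime_snoc_last (j : Fin K → α) (x : α) :
    passTime S T (Fin.snoc j x : Fin (K + 1) → α) (K + 1) =
      nextTime S T (passTime S T j K) x := by
  rw [passTime, dif_pos (Nat.lt_succ_self K), passTime_snoc S T j x le_rfl]
  congr 1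
  exact Fin.snoc_last (α := fun _ => α) x j

end PassTime

/-- The weight of a passing time: it decreases by the factor `e` in `n / 4` steps, and vanishes
after the horizon. -/
noncomputable def timeWeight (n T t : ℕ) : ℝ := if t ≤ T then Real.exp (-(4 * t / n)) else 0

theorem timeWeight_nonneg (n T t : ℕ) : 0 ≤ timeWeight n T t := by
  unfold timeWeight; split_ifs <;> positivity

theorem timeWeight_anti (n T : ℕ) : Antitone (timeWeight n T) := by
  intro s t h
  unfold timeWeight
  split_ifs with h1 h2 h2
  · apply Real.exp_le_exp.2
    gcongr
  · omega
  · positivity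
  · exact le_rfl

theorem timeWeight_add {n : ℕ} (hn : 0 < n) (T t : ℕ) {r : ℕ} (hr : n ≤ 4 * r) :
    timeWeight n T (t + r) ≤ (1 / 2) * timeWeight n T t := by
  unfold timeWeight
  split_ifs with h1 h2 h2
  · have h : Real.exp (-(4 * (t + r : ℕ) / n)) ≤ Real.exp (-(4 * t / n)) * Real.exp (-1) := by
      rw [← Real.exp_add, Real.exp_le_exp]
      have hn' : (0 : ℝ) < n := by exact_mod_cast hn
      have : (n : ℝ) ≤ 4 * r := by exact_mod_cast hr
      have h4 : (1 : ℝ) ≤ 4 * r / n := by rw [le_div_iff₀ hn']; linarith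
      push_cast
      rw [mul_add, add_div]
      linarith
    have h' : Real.exp (-1) ≤ 1 / 2 := by
      have := Real.exp_neg_one_lt_d9
      linarith
    nlinarith [Real.exp_pos (-(4 * (t : ℝ) / n))]
  · omega
  · positivity
  · simp

/-- The indices among the last `⌊n / 2⌋` queries, up to query number `t`. -/
def window {n : ℕ} (i : ℕ → Fin n) (t : ℕ) : Finset (Fin n) :=
  ((Finset.range (t + 1)).filter fun τ => t + 1 ≤ τ + n / 2).image i

/-- Averaged over the label, waiting for it costs a constant factor of the weight: at least a
quarter of the labels are not in any window during the next `n / 4` steps. -/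
theorem sum_timeWeight_nextTime_le {n : ℕ} (i : ℕ → Fin n) (T t : ℕ) :
    ∑ x, timeWeight n T (nextTime (window i) T t x) ≤ n * (7 / 8) * timeWeight n T t := by
  rcases Nat.eq_zero_or_pos n with rfl | hn
  · simp
  set U : Finset (Fin n) := (Finset.Icc (t + 1 - n / 2) (t + n / 4)).image i with hU
  have hUcard : 4 * U.card ≤ 3 * n := by
    have := Finset.card_image_le (s := Finset.Icc (t + 1 - n / 2) (t + n / 4)) (f := i)
    rw [Nat.card_Icc, ← hU] at this
    omega
  have hw := timeWeight_nonneg n T t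
  have key : ∀ x, timeWeight n T (nextTime (window i) T t x) ≤
      if x ∈ U then timeWeight n T t else (1 / 2) * timeWeight n T t := by
    intro x
    obtain ⟨h1, h2⟩ := nextTime_spec (window i) T t x
    split_ifs with hx
    · exact timeWeight_anti n T h1
    · rcases h2 with h2 | h2
      · refine le_trans (timeWeight_anti n T (a := t + (n / 4 + 1)) ?_)
          (timeWeight_add hn T t (by omega))
        by_contra hlt
        apply hx
        obtain ⟨s, hs, rfl⟩ := Finset.mem_image.1 h2
        rw [Finset.mem_filter, Finset.mem_range] at hs
        exact Finset.mem_image_of_mem i (Finset.mem_Icc.2 (by omega))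
      · rw [timeWeight, if_neg (by omega)]
        positivity
  refine (Finset.sum_le_sum fun x _ => key x).trans ?_
  have hc : ((Finset.univ.filter fun x => x ∉ U).card : ℝ) = n - U.card := by
    have h := Finset.card_filter_add_card_filter_not (s := (Finset.univ : Finset (Fin n))) (· ∈ U)
    rw [Finset.filter_mem_eq_inter, Finset.univ_inter, Finset.card_univ, Fintype.card_fin] at h
    rw [eq_sub_iff_add_eq, add_comm]
    exact_mod_cast h
  rw [Finset.sum_ite, Finset.sum_const, Finset.sum_const, nsmul_eq_mul, nsmul_eq_mul, hc,
    Finset.filter_mem_eq_inter, Finset.univ_inter]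
  have : 4 * (U.card : ℝ) ≤ 3 * n := by exact_mod_cast hUcard
  nlinarith

theorem sum_timeWeight_passTime_le {n : ℕ} (i : ℕ → Fin n) (T K : ℕ) :
    ∑ j : Fin K → Fin n, timeWeight n T (passTime (window i) T j K) ≤ (n * (7 / 8)) ^ K := by
  induction K with
  | zero => simp [passTime, timeWeight]
  | succ K ih =>
    rw [← (Fin.snocEquiv fun _ : Fin (K + 1) => Fin n).sum_comp, Fintype.sum_prod_type_right]
    calc _ = ∑ j : Fin K → Fin n, ∑ x,
          timeWeight n T (nextTime (window i) T (passTime (window i) T j K) x) := by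
          refine Finset.sum_congr rfl fun j _ => Finset.sum_congr rfl fun x _ => ?_
          exact congrArg _ (passTime_snoc_last (window i) T j x)
      _ ≤ ∑ j : Fin K → Fin n, n * (7 / 8) * timeWeight n T (passTime (window i) T j K) :=
          Finset.sum_le_sum fun j _ => sum_timeWeight_nextTime_le i T _
      _ ≤ _ := by
          rw [← Finset.mul_sum, pow_succ']
          gcongr

/-- If there are at most `n K / 64` steps, then at least one label sequence in sixteen is not
passed. -/
theorem card_le_of_passTime {n : ℕ} (hn : 0 < n) (i : ℕ → Fin n) {T K : ℕ} (hK : 1 ≤ K)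
    (hT : 64 * T ≤ n * K) :
    (n : ℝ) ^ K ≤
      16 * (Finset.univ.filter fun j : Fin K → Fin n => T < passTime (window i) T j K).card := by
  set G := Finset.univ.filter fun j : Fin K → Fin n => passTime (window i) T j K ≤ T with hG
  have hn' : (0 : ℝ) < n := by exact_mod_cast hn
  have h1 : (G.card : ℝ) * Real.exp (-(4 * T / n)) ≤ (n * (7 / 8)) ^ K := by
    refine le_trans ?_ (sum_timeWeight_passTime_le i T K)
    rw [← nsmul_eq_mul, ← Finset.sum_const]
    refine le_trans (Finset.sum_le_sum fun j hj => ?_)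
      (Finset.sum_le_sum_of_subset_of_nonneg (Finset.filter_subset _ _)
        fun j _ _ => timeWeight_nonneg n T _)
    have hj : passTime (window i) T j K ≤ T := (Finset.mem_filter.1 hj).2
    refine le_trans (le_of_eq ?_) (timeWeight_anti n T hj)
    simp [timeWeight]
  have h2 : Real.exp (4 * T / n) ≤ (15 / 14) ^ K := by
    have : (4 * T / n : ℝ) ≤ K * (1 / 16) := by
      rw [div_le_iff₀ hn']
      have : (64 * T : ℝ) ≤ n * K := by exact_mod_cast hT
      linarith
    refine (Real.exp_le_exp.2 this).trans ?_
    rw [Real.exp_nat_mul]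
    refine pow_le_pow_left₀ (Real.exp_nonneg _) ?_ K
    refine (Real.exp_bound_div_one_sub_of_interval (by norm_num) (by norm_num)).trans ?_
    norm_num
  have h3 : (G.card : ℝ) ≤ n ^ K * (15 / 16) := by
    calc (G.card : ℝ) = G.card * Real.exp (-(4 * T / n)) * Real.exp (4 * T / n) := by
          rw [mul_assoc, ← Real.exp_add]; simp
      _ ≤ (n * (7 / 8)) ^ K * (15 / 14) ^ K := by gcongr
      _ = n ^ K * (15 / 16) ^ K := by rw [mul_pow, mul_assoc, ← mul_pow]; norm_num
      _ ≤ n ^ K * (15 / 16) ^ 1 := by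
          gcongr ?_ * ?_
          exact pow_le_pow_of_le_one (by norm_num) (by norm_num) hK
      _ = _ := by rw [pow_one]
  have h4 := Finset.card_filter_add_card_filter_not (s := (Finset.univ : Finset (Fin K → Fin n)))
    (fun j => passTime (window i) T j K ≤ T)
  simp only [not_le, Finset.card_univ, Fintype.card_fun, Fintype.card_fin] at h4
  have h5 : (G.card : ℝ) +
    (Finset.univ.filter fun j : Fin K → Fin n => T < passTime (window i) T j K).card = n ^ K := by
    exact_mod_cast h4
  linarith

/-! ### Coordinates of the chains -/

/-- `N` chains of length `k + 1` are placed one after the other; this is the coordinate of link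
`l` of chain `B`. -/
def pos {N k : ℕ} (B : Fin N) (l : Fin (k + 1)) : Fin (N * (k + 1)) := finProdFinEquiv (B, l)

section Pos
variable {N k : ℕ}

theorem pos_val (B : Fin N) (l : Fin (k + 1)) : (pos B l : ℕ) = l + (k + 1) * B := rfl

theorem pos_inj {B B' : Fin N} {l l' : Fin (k + 1)} : pos B l = pos B' l' ↔ B = B' ∧ l = l' := by
  simp [pos]

theorem exists_pos (r : Fin (N * (k + 1))) : ∃ B l, r = pos B l :=
  ⟨(finProdFinEquiv.symm r).1, (finProdFinEquiv.symm r).2,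
    (finProdFinEquiv.apply_symm_apply r).symm⟩

theorem sum_pos (g : Fin (N * (k + 1)) → ℝ) : ∑ r, g r = ∑ B, ∑ l, g (pos B l) := by
  rw [← finProdFinEquiv.sum_comp, Fintype.sum_prod_type]
  rfl

/-- The labelling that cuts out the links of chain `B` from number `m` on: these coordinates have
the label `1`, the ones before them `0`, and the ones after them `2`. -/
def cut (k B m : ℕ) (r : ℕ) : ℕ :=
  if r < (k + 1) * B + m then 0 else if r < (k + 1) * (B + 1) then 1 else 2

theorem cut_monotone (k B m : ℕ) : Monotone (cut k B m) := by
  intro r s h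
  unfold cut
  split_ifs <;> omega

theorem cut_pos (B C : Fin N) (m : ℕ) (l : Fin (k + 1)) (hm : m ≤ k + 1) :
    cut k B m (pos C l : ℕ) =
      if C < B then 0 else if C = B then (if (l : ℕ) < m then 0 else 1) else 2 := by
  rw [pos_val, cut]
  have hl := l.2
  rcases lt_trichotomy C B with h | rfl | h
  · rw [if_pos h]
    have h' : (C : ℕ) + 1 ≤ B := h
    have := Nat.mul_le_mul_left (k + 1) h'
    rw [mul_add] at this
    rw [if_pos (by omega)]
  · rw [if_neg (lt_irrefl _), if_pos rfl]
    have : (k + 1) * ((C : ℕ) + 1) = (k + 1) * C + (k + 1) := by ring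
    split_ifs <;> omega
  · rw [if_neg h.not_gt, if_neg h.ne']
    have h' : (B : ℕ) + 1 ≤ C := h
    have h2 := Nat.mul_le_mul_left (k + 1) h'
    have h3 : (k + 1) * ((B : ℕ) + 1) = (k + 1) * B + (k + 1) := by ring
    rw [if_neg (by omega), if_neg (by omega)]

end Pos

/-! ### The hard instance: chains of quadratics -/

/-- The difference of the unit vectors of the links `l` and `l + 1` of chain `B`. -/
def edgeVec {N k : ℕ} (B : Fin N) (l : Fin k) : Fin (N * (k + 1)) → ℝ :=
  Pi.single (pos B l.castSucc) 1 - Pi.single (pos B l.succ) 1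

/-- The matrix of the quadratic form
`lam |w|² + ∑ B (α ∑ₗ (w_{B,l} - w_{B,l+1})² + τ w_{B,k}²)`, where the inner sum is over those `l`
for which the link `l + 1` of the chain `B` has the label `i`. -/
def chainMatrix {n N k : ℕ} (J : Fin N → Fin (k + 1) → Fin n) (lam α τ : ℝ) (i : Fin n) :
    Matrix (Fin (N * (k + 1))) (Fin (N * (k + 1))) ℝ :=
  lam • 1 + ∑ B, ((∑ l : Fin k, (if J B l.succ = i then α else 0) •
      Matrix.vecMulVec (edgeVec B l) (edgeVec B l)) +
    τ • Matrix.vecMulVec (Pi.single (pos B (Fin.last k)) 1) (Pi.single (pos B (Fin.last k)) 1))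

/-- The linear term: it enters the chains whose first link has the label `i`. -/
noncomputable def chainVec {n N k : ℕ} (J : Fin N → Fin (k + 1) → Fin n) (β : ℝ) (i : Fin n) :
    E (N * (k + 1)) :=
  ∑ B, EuclideanSpace.single (pos B 0) (if J B 0 = i then -β else 0)

/-- The hard instance: the `i`-th function owns the links with label `i`. -/
noncomputable def chainFun {n N k : ℕ} (J : Fin N → Fin (k + 1) → Fin n) (lam α τ β : ℝ)
    (i : Fin n) : E (N * (k + 1)) → ℝ :=
  quadratic (chainMatrix J lam α τ i) (chainVec J β i)

section Chain
variable {n N k : ℕ} (J : Fin N → Fin (k + 1) → Fin n) (lam α τ β : ℝ)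

theorem chainMatrix_isHermitian (i : Fin n) : (chainMatrix J lam α τ i).IsHermitian := by
  ext r s
  simp only [chainMatrix, Matrix.conjTranspose_apply, star_trivial, Matrix.add_apply,
    Matrix.smul_apply, Matrix.sum_apply, Matrix.vecMulVec_apply, Matrix.one_apply, smul_eq_mul]
  simp only [mul_comm, eq_comm]

theorem dotProduct_chainMatrix (i : Fin n) (x : Fin (N * (k + 1)) → ℝ) :
    dotProduct x ((chainMatrix J lam α τ i).mulVec x) = lam * ∑ r, x r ^ 2 +
      ∑ B, ((∑ l : Fin k, (if J B l.succ = i then α else 0) *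
        (x (pos B l.castSucc) - x (pos B l.succ)) ^ 2) + τ * x (pos B (Fin.last k)) ^ 2) := by
  have h (u : Fin (N * (k + 1)) → ℝ) :
      dotProduct x ((Matrix.vecMulVec u u).mulVec x) = (dotProduct u x) ^ 2 := by
    rw [Matrix.vecMulVec_mulVec, dotProduct_smul]
    simp [pow_two, dotProduct_comm]
  have h2 (B : Fin N) (l : Fin k) : dotProduct (edgeVec B l) x =
      x (pos B l.castSucc) - x (pos B l.succ) := by
    simp [edgeVec, sub_dotProduct]
  simp only [chainMatrix, Matrix.add_mulVec, Matrix.smul_mulVec, Matrix.sum_mulVec,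
    dotProduct_add, dotProduct_smul, dotProduct_sum, h, h2, Matrix.one_mulVec, smul_eq_mul,
    single_dotProduct, one_mul]
  simp [dotProduct, pow_two]

theorem chainFun_apply (i : Fin n) (w : E (N * (k + 1))) :
    chainFun J lam α τ β i w = ∑ B, (lam / 2 * ∑ l, w (pos B l) ^ 2 +
      (∑ l : Fin k, (if J B l.succ = i then α / 2 else 0) *
        (w (pos B l.castSucc) - w (pos B l.succ)) ^ 2) + τ / 2 * w (pos B (Fin.last k)) ^ 2 -
      (if J B 0 = i then β else 0) * w (pos B 0)) := by
  have h1 : inner ℝ w (Matrix.toEuclideanLin (chainMatrix J lam α τ i) w) =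
      dotProduct w.ofLp ((chainMatrix J lam α τ i).mulVec w.ofLp) := by
    simp [Matrix.toLpLin_apply, PiLp.inner_apply, dotProduct, mul_comm]
  have h2 : inner ℝ (chainVec J β i) w = ∑ B, -((if J B 0 = i then β else 0) * w (pos B 0)) := by
    simp only [chainVec, sum_inner, EuclideanSpace.inner_single_left]
    refine Finset.sum_congr rfl fun B _ => ?_
    split_ifs <;> simp
  rw [chainFun, quadratic, h1, h2, dotProduct_chainMatrix, sum_pos, Finset.mul_sum,
    ← Finset.sum_add_distrib, Finset.mul_sum, ← Finset.sum_add_distrib]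
  refine Finset.sum_congr rfl fun B _ => ?_
  have h3 : ∑ l : Fin k, (if J B l.succ = i then α / 2 else 0) *
        (w (pos B l.castSucc) - w (pos B l.succ)) ^ 2 =
      1 / 2 * ∑ l : Fin k, (if J B l.succ = i then α else 0) *
        (w (pos B l.castSucc) - w (pos B l.succ)) ^ 2 := by
    rw [Finset.mul_sum]
    refine Finset.sum_congr rfl fun l _ => ?_
    split_ifs <;> ring
  rw [h3]
  ring

/-- Each link occurs in at most two squares `(w_{B,l} - w_{B,l+1})² ≤ 2 w_{B,l}² + 2 w_{B,l+1}²`. -/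
theorem chainFun_isInstance (hα : 0 ≤ α) (hτ : 0 ≤ τ) (hτα : τ ≤ α) :
    IsInstance (lam + 4 * α) lam (chainFun J lam α τ β) := by
  refine fun i => ⟨isQuadratic_quadratic _ _,
    smoothStronglyConvex_quadratic (chainMatrix_isHermitian J lam α τ i) _ (fun x => ?_)
      fun x => ?_⟩
  · rw [dotProduct_chainMatrix]
    refine le_add_of_nonneg_right (Finset.sum_nonneg fun B _ => add_nonneg
      (Finset.sum_nonneg fun l _ => mul_nonneg ?_ (sq_nonneg _)) (by positivity))
    split_ifs
    · exact hα
    · exact le_rfl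
  · rw [dotProduct_chainMatrix, add_mul, add_le_add_iff_left, sum_pos, Finset.mul_sum]
    refine Finset.sum_le_sum fun B _ => ?_
    have h1 : ∀ l : Fin k, (if J B l.succ = i then α else 0) *
        (x (pos B l.castSucc) - x (pos B l.succ)) ^ 2 ≤
        2 * α * x (pos B l.castSucc) ^ 2 + 2 * α * x (pos B l.succ) ^ 2 := by
      intro l
      have h2 : (x (pos B l.castSucc) - x (pos B l.succ)) ^ 2 ≤
          2 * x (pos B l.castSucc) ^ 2 + 2 * x (pos B l.succ) ^ 2 := by
        nlinarith [sq_nonneg (x (pos B l.castSucc) + x (pos B l.succ))]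
      split_ifs
      · nlinarith
      · rw [zero_mul]; positivity
    have h3 := Finset.sum_le_sum fun l (_ : l ∈ Finset.univ) => h1 l
    rw [Finset.sum_add_distrib, ← Finset.mul_sum, ← Finset.mul_sum] at h3
    have h4 := Fin.sum_univ_castSucc fun l => x (pos B l) ^ 2
    have h5 := Fin.sum_univ_succ fun l => x (pos B l) ^ 2
    have h6 : τ * x (pos B (Fin.last k)) ^ 2 ≤ α * x (pos B (Fin.last k)) ^ 2 := by gcongr
    have h7 := mul_nonneg hα (sq_nonneg (x (pos B (Fin.last k))))
    have h8 := mul_nonneg hα (sq_nonneg (x (pos B 0)))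
    rw [eq_sub_iff_add_eq.2 h4.symm, eq_sub_iff_add_eq'.2 h5.symm] at h3
    linarith

/-- The objective is a sum of identical functions of the single chains, whatever the labels. -/
theorem objective_chainFun (hn : 0 < n) (w : E (N * (k + 1))) :
    objective (chainFun J lam α τ β) w = ∑ B, (lam / 2 * ∑ l, w (pos B l) ^ 2 +
      α / n / 2 * (∑ l : Fin k, (w (pos B l.castSucc) - w (pos B l.succ)) ^ 2) +
      τ / 2 * w (pos B (Fin.last k)) ^ 2 - β / n * w (pos B 0)) := by
  have hn' : (n : ℝ) ≠ 0 := by exact_mod_cast hn.ne'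
  simp only [objective, chainFun_apply]
  rw [Finset.sum_comm, Finset.mul_sum]
  refine Finset.sum_congr rfl fun B _ => ?_
  rw [Finset.sum_sub_distrib, Finset.sum_add_distrib, Finset.sum_add_distrib, Finset.sum_comm]
  simp only [← Finset.sum_mul, Finset.sum_ite_eq, Finset.mem_univ, if_true, Finset.sum_const,
    Finset.card_univ, Fintype.card_fin, nsmul_eq_mul]
  rw [← Finset.mul_sum]
  field_simp

theorem gradient_chainFun (i : Fin n) (w : E (N * (k + 1))) :
    gradient (chainFun J lam α τ β i) w =
      Matrix.toEuclideanLin (chainMatrix J lam α τ i) w + chainVec J β i :=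
  gradient_quadratic (chainMatrix_isHermitian J lam α τ i) _ w

theorem hessian_chainFun (i : Fin n) (w : E (N * (k + 1))) :
    hessian (chainFun J lam α τ β i) w = chainMatrix J lam α τ i :=
  hessian_quadratic (chainMatrix_isHermitian J lam α τ i) _ w

/-- The `i`-th Hessian decomposes before every link that does not have the label `i`. -/
theorem isBlockDiagonal_chainMatrix {i : Fin n} {B : Fin N} {m : Fin (k + 1)} (h : J B m ≠ i) :
    IsBlockDiagonal (fun r => cut k B m (r : ℕ)) (chainMatrix J lam α τ i) := by
  intro r s hrs
  have hne : r ≠ s := fun h => hrs (by rw [h])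
  simp only [chainMatrix, Matrix.add_apply, Matrix.smul_apply, Matrix.sum_apply,
    Matrix.one_apply_ne hne, mul_zero, zero_add, Matrix.vecMulVec_apply, smul_eq_mul]
  refine Finset.sum_eq_zero fun C _ => ?_
  have h1 : (Pi.single (pos C (Fin.last k)) (1 : ℝ) : Fin (N * (k + 1)) → ℝ) r *
      (Pi.single (pos C (Fin.last k)) (1 : ℝ) : Fin (N * (k + 1)) → ℝ) s = 0 := by
    simp only [Pi.single_apply]
    split_ifs with h1 h2
    · exact absurd (h1.trans h2.symm) hne
    all_goals simp
  rw [h1, mul_zero, add_zero]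
  refine Finset.sum_eq_zero fun l _ => ?_
  by_cases hl : J C l.succ = i
  swap
  · rw [if_neg hl, zero_mul]
  -- both ends of an edge with label `i` lie on the same side of the cut
  have hc : cut k B m (pos C l.castSucc : ℕ) = cut k B m (pos C l.succ : ℕ) := by
    rw [cut_pos _ _ _ _ m.2.le, cut_pos _ _ _ _ m.2.le]
    by_cases hCB : C = B
    · subst hCB
      have : (m : ℕ) ≠ l + 1 := fun h' => h (by
        rw [← hl]; congr 1; exact Fin.ext h')
      simp only [Fin.val_castSucc, Fin.val_succ]
      split_ifs <;> omega
    · simp [hCB]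
  have h2 : edgeVec C l r * edgeVec C l s = 0 := by
    by_contra h0
    have hmem : ∀ q, edgeVec C l q ≠ 0 → q = pos C l.castSucc ∨ q = pos C l.succ := by
      intro q hq
      by_contra! hq'
      exact hq (by simp [edgeVec, hq'.1, hq'.2])
    rcases hmem r (left_ne_zero_of_mul h0) with rfl | rfl <;>
    rcases hmem s (right_ne_zero_of_mul h0) with rfl | rfl <;>
    simp_all
  rw [h2, mul_zero]

end Chain

/-! ### The coordinates reached by linear-algebraic computations -/
section Support
variable {n N k : ℕ} (J : Fin N → Fin (k + 1) → Fin n) (lam α τ β : ℝ)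

/-- A matrix that respects the cut maps vectors vanishing behind the cut to such vectors. -/
theorem toEuclideanLin_apply_eq_zero {B : Fin N} {m : Fin (k + 1)}
    {H : Matrix (Fin (N * (k + 1))) (Fin (N * (k + 1))) ℝ}
    (hH : IsBlockDiagonal (fun r => cut k B m (r : ℕ)) H) {v : E (N * (k + 1))}
    (hv : ∀ l, m ≤ l → v (pos B l) = 0) {l : Fin (k + 1)} (hl : m ≤ l) :
    Matrix.toEuclideanLin H v (pos B l) = 0 := by
  simp only [Matrix.toLpLin_apply, Matrix.mulVec, dotProduct]
  refine Finset.sum_eq_zero fun s _ => ?_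
  obtain ⟨C, l', rfl⟩ := exists_pos s
  by_cases h : C = B ∧ m ≤ l'
  · rw [h.1, hv l' h.2, mul_zero]
  · rw [hH, zero_mul]
    simp only [cut_pos _ _ _ _ m.2.le, lt_irrefl, if_false, if_true]
    have hl' : ¬ (l : ℕ) < m := not_lt.2 hl
    rw [if_neg hl']
    by_cases hC : C = B
    · have : (l' : ℕ) < m := by simpa [hC] using h
      simp [hC, this]
    · simp only [hC, if_false]
      split_ifs <;> omega

/-- If a link has not been passed by time `t`, then the first such link of its chain has a label
outside the current window. -/
theorem exists_notMem_window {K : ℕ} (S : ℕ → Finset (Fin n)) (T : ℕ) (j : Fin K → Fin n) {t : ℕ}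
    {l : Fin K} (h : t + 1 ≤ passTime S T j (l + 1)) :
    ∃ m : Fin K, m ≤ l ∧ j m ∉ S t ∧ t + 1 ≤ passTime S T j (m + 1) := by
  classical
  have hex : ∃ m : ℕ, t + 1 ≤ passTime S T j (m + 1) := ⟨l, h⟩
  have hml : Nat.find hex ≤ l := Nat.find_min' hex h
  refine ⟨⟨Nat.find hex, hml.trans_lt l.2⟩, hml, fun hm => ?_, Nat.find_spec hex⟩
  have hle : passTime S T j (Nat.find hex) ≤ t := by
    rcases Nat.eq_zero_or_pos (Nat.find hex) with h0 | h0
    · rw [h0]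
      exact Nat.zero_le t
    · have := Nat.find_min hex (Nat.sub_one_lt h0.ne')
      rw [Nat.sub_add_cancel h0] at this
      omega
  have h1 := passTime_succ_le S T j (l := ⟨Nat.find hex, hml.trans_lt l.2⟩) hle hm
  have h2 := Nat.find_spec hex
  simp only at h1
  omega

theorem mem_window_self (hn : 1 < n) (i : ℕ → Fin n) (t : ℕ) : i t ∈ window i t :=
  Finset.mem_image_of_mem i (Finset.mem_filter.2 ⟨Finset.mem_range.2 (by omega), by omega⟩)

theorem chainVec_apply (i : Fin n) (B : Fin N) (l : Fin (k + 1)) :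
    chainVec J β i (pos B l) = if l = 0 ∧ J B 0 = i then -β else 0 := by
  simp only [chainVec, WithLp.ofLp_sum, Finset.sum_apply, PiLp.single_apply, pos_inj]
  rw [Finset.sum_eq_single B]
  · split_ifs <;> simp_all
  · intro C _ hC
    rw [if_neg (fun h => hC h.1.symm)]
  · simp

/-- Linear-algebraic computations make a coordinate nonzero only after its link is passed: every
matrix available at time `t` respects the cuts before the links with labels outside the window,
since it inherits them from a combination of Hessians with labels in the window. -/
theorem apply_eq_zero_of_mem_permitted (hn : 1 < n) (T : ℕ) {w : ℕ → E (N * (k + 1))}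
    {i : ℕ → Fin n}
    (hw : ∀ t, w t ∈ permitted (chainFun J lam α τ β) w i t) (t : ℕ) :
    ∀ v ∈ permitted (chainFun J lam α τ β) w i t, ∀ (B : Fin N) (l : Fin (k + 1)),
      t ≤ passTime (window i) T (J B) (l + 1) → v (pos B l) = 0 := by
  induction t with
  | zero =>
    intro v hv B l _
    rw [permitted, Set.mem_singleton_iff] at hv
    simp [hv]
  | succ t ih =>
    -- multiplication by a matrix that respects the cuts outside the window
    have hmul : ∀ H : Matrix (Fin (N * (k + 1))) (Fin (N * (k + 1))) ℝ,
        (∀ (B : Fin N) (m : Fin (k + 1)), J B m ∉ window i t →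
          IsBlockDiagonal (fun r => cut k B m (r : ℕ)) H) →
        ∀ v : E (N * (k + 1)), (∀ (B : Fin N) (l : Fin (k + 1)),
          t + 1 ≤ passTime (window i) T (J B) (l + 1) → v (pos B l) = 0) →
        ∀ (B : Fin N) (l : Fin (k + 1)),
          t + 1 ≤ passTime (window i) T (J B) (l + 1) →
            Matrix.toEuclideanLin H v (pos B l) = 0 := by
      intro H hH v hv B l hl
      obtain ⟨m, hml, hm, hmt⟩ := exists_notMem_window (window i) T (J B) hl
      refine toEuclideanLin_apply_eq_zero (hH B m hm) (fun l' hl' => hv B l' ?_) hml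
      exact hmt.trans (passTime_mono _ T (J B) (Nat.succ_le_succ hl'))
    have hA : ∀ i' ∈ window i t, ∀ (B : Fin N) (m : Fin (k + 1)), J B m ∉ window i t →
        IsBlockDiagonal (fun r => cut k B m (r : ℕ)) (chainMatrix J lam α τ i') :=
      fun i' hi' B m hm =>
        isBlockDiagonal_chainMatrix J lam α τ fun h => hm (h ▸ hi')
    have hder : ∀ v, Derived (permitted (chainFun J lam α τ β) w i t ∪
          {gradient (chainFun J lam α τ β (i t)) (w t)})
          (allowedMatrices (chainFun J lam α τ β) w i t) v →
        ∀ (B : Fin N) (l : Fin (k + 1)),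
          t + 1 ≤ passTime (window i) T (J B) (l + 1) → v (pos B l) = 0 := by
      intro v hv
      induction hv with
      | base h =>
        intro B l hl
        rcases h with h | h
        · exact ih _ h B l (by omega)
        · rw [Set.mem_singleton_iff.1 h, gradient_chainFun, PiLp.add_apply,
            hmul _ (hA (i t) (mem_window_self hn i t)) (w t)
              (fun B l hl => ih _ (hw t) B l (by omega)) B l hl, zero_add, chainVec_apply,
            if_neg]
          rintro ⟨rfl, h0⟩
          have := passTime_succ_le (window i) T (J B) (l := 0) (t := t) (Nat.zero_le t)
            (h0 ▸ mem_window_self hn i t)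
          simp only [Fin.val_zero] at hl this
          omega
      | comb a a' _ _ ih1 ih2 =>
        intro B l hl
        rw [PiLp.add_apply, PiLp.smul_apply, PiLp.smul_apply, ih1 B l hl, ih2 B l hl]
        simp
      | mul hH _ ih1 =>
        refine hmul _ (fun B m hm => ?_) _ ih1
        obtain ⟨a, ha⟩ := hH
        refine ha (fun r => cut k B m (r : ℕ)) (fun r s h => cut_monotone k B m h) ?_
        intro r s hrs
        simp only [hessian_chainFun, Matrix.sum_apply, Matrix.smul_apply]
        refine Finset.sum_eq_zero fun s' hs' => ?_
        rw [hA (i s') (Finset.mem_image_of_mem i hs') B m hm r s hrs, smul_zero]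
    intro v hv B l hl
    have hclosed : IsClosed {v : E (N * (k + 1)) | v (pos B l) = 0} :=
      isClosed_eq (by fun_prop) continuous_const
    exact closure_minimal (fun v hv => hder v hv B l hl) hclosed hv

end Support

/-! ### Suboptimality of points that do not reach the end of a chain -/

/-- The quadratic part of the contribution of a single chain to the objective. -/
noncomputable def chainEnergy {k : ℕ} (lam σ q : ℝ) (u : Fin (k + 1) → ℝ) : ℝ :=
  lam / 2 * ∑ l, u l ^ 2 + σ / 2 * (∑ l : Fin k, (u l.castSucc - u l.succ) ^ 2) +
    σ * (1 - q) / 2 * u (Fin.last k) ^ 2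

section Energy
variable {k : ℕ} {lam σ q : ℝ}

/-- The first-order condition for the geometric sequence `1, q, q², …`, tested with `v`. -/
theorem chain_stationary (h : lam * q = σ * (1 - q) ^ 2) (k : ℕ) (v : Fin (k + 1) → ℝ) :
    lam * ∑ l : Fin (k + 1), q ^ (l : ℕ) * v l +
      σ * ∑ l : Fin k, (q ^ (l : ℕ) - q ^ (l + 1 : ℕ)) * (v l.castSucc - v l.succ) +
      σ * (1 - q) * (q ^ k * v (Fin.last k)) = (lam + σ * (1 - q)) * v 0 := by
  induction k with
  | zero => simp; ring
  | succ k ih =>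
    have h1 := ih fun l => v l.castSucc
    rw [Fin.sum_univ_castSucc, Fin.sum_univ_castSucc
      fun l : Fin (k + 1) => (q ^ (l : ℕ) - q ^ (l + 1 : ℕ)) * (v l.castSucc - v l.succ)]
    simp only [Fin.val_castSucc, Fin.val_last, Fin.castSucc_zero, Fin.succ_last,
      Fin.succ_castSucc] at h1 ⊢
    rw [← h1]
    linear_combination q ^ k * v (Fin.last (k + 1)) * h

theorem chainEnergy_sub (h : lam * q = σ * (1 - q) ^ 2) (u : Fin (k + 1) → ℝ) :
    chainEnergy lam σ q u - (lam + σ * (1 - q)) * u 0 =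
      chainEnergy lam σ q (fun l => u l - q ^ (l : ℕ)) - (lam + σ * (1 - q)) / 2 := by
  have h1 := chain_stationary h k u
  have h2 := chain_stationary h k fun l => q ^ (l : ℕ)
  have e1 : ∑ l : Fin (k + 1), (u l - q ^ (l : ℕ)) ^ 2 = ∑ l, u l ^ 2 -
      2 * ∑ l : Fin (k + 1), q ^ (l : ℕ) * u l +
      ∑ l : Fin (k + 1), q ^ (l : ℕ) * q ^ (l : ℕ) := by
    rw [Finset.mul_sum, ← Finset.sum_sub_distrib, ← Finset.sum_add_distrib]
    exact Finset.sum_congr rfl fun l _ => by ring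
  have e2 : ∑ l : Fin k, (u l.castSucc - q ^ (l : ℕ) - (u l.succ - q ^ (l + 1 : ℕ))) ^ 2 =
      ∑ l : Fin k, (u l.castSucc - u l.succ) ^ 2 -
      2 * ∑ l : Fin k, (q ^ (l : ℕ) - q ^ (l + 1 : ℕ)) * (u l.castSucc - u l.succ) +
      ∑ l : Fin k, (q ^ (l : ℕ) - q ^ (l + 1 : ℕ)) * (q ^ (l : ℕ) - q ^ (l + 1 : ℕ)) := by
    rw [Finset.mul_sum, ← Finset.sum_sub_distrib, ← Finset.sum_add_distrib]
    exact Finset.sum_congr rfl fun l _ => by ring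
  simp only [Fin.val_castSucc, Fin.val_succ, Fin.val_last, Fin.val_zero, pow_zero, mul_one] at h2
  simp only [chainEnergy, Fin.val_castSucc, Fin.val_succ, Fin.val_last, e1, e2]
  linear_combination h1 - h2 / 2

theorem le_chainEnergy (hlam : 0 ≤ lam) (hσ : 0 ≤ σ) (hq : q ≤ 1) (u : Fin (k + 1) → ℝ)
    (l : Fin (k + 1)) : lam / 2 * u l ^ 2 ≤ chainEnergy lam σ q u := by
  have h1 := Finset.single_le_sum (f := fun l => u l ^ 2) (fun l _ => sq_nonneg _)
    (Finset.mem_univ l)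
  have h2 : 0 ≤ 1 - q := by linarith
  calc lam / 2 * u l ^ 2 ≤ lam / 2 * ∑ l, u l ^ 2 := by gcongr
    _ ≤ _ := by
      rw [chainEnergy, add_assoc]
      exact le_add_of_nonneg_right (by positivity)

end Energy

section Gap
variable {n N k : ℕ} (J : Fin N → Fin (k + 1) → Fin n) {lam σ q : ℝ}

/-- The objective of the hard instance, in which every chain has the optimum `1, q, …, q ^ k`. -/
theorem objective_eq (hn : 0 < n) (h : lam * q = σ * (1 - q) ^ 2) (w : E (N * (k + 1))) :
    objective (chainFun J lam (n * σ) (σ * (1 - q)) (n * (lam + σ * (1 - q)))) w =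
      ∑ B, chainEnergy lam σ q (fun l : Fin (k + 1) => w (pos B l) - q ^ (l : ℕ)) -
        N * ((lam + σ * (1 - q)) / 2) := by
  have hn' : (n : ℝ) ≠ 0 := by exact_mod_cast hn.ne'
  rw [objective_chainFun _ _ _ _ _ hn, mul_div_cancel_left₀ _ hn', mul_div_cancel_left₀ _ hn']
  have : (N : ℝ) * ((lam + σ * (1 - q)) / 2) = ∑ _B : Fin N, (lam + σ * (1 - q)) / 2 := by simp
  rw [this, ← Finset.sum_sub_distrib]
  refine Finset.sum_congr rfl fun B _ => ?_
  rw [← chainEnergy_sub h]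
  rfl

/-- The optimum of the hard instance. -/
noncomputable def chainOpt (N k : ℕ) (q : ℝ) : E (N * (k + 1)) :=
  WithLp.toLp 2 fun r => q ^ ((finProdFinEquiv.symm r).2 : ℕ)

theorem chainOpt_pos (q : ℝ) (B : Fin N) (l : Fin (k + 1)) :
    chainOpt N k q (pos B l) = q ^ (l : ℕ) := by
  simp only [chainOpt, pos, Equiv.symm_apply_apply]

theorem objective_chainOpt (hn : 0 < n) (h : lam * q = σ * (1 - q) ^ 2) :
    objective (chainFun J lam (n * σ) (σ * (1 - q)) (n * (lam + σ * (1 - q)))) (chainOpt N k q) =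
      -(N * ((lam + σ * (1 - q)) / 2)) := by
  rw [objective_eq J hn h]
  simp [chainOpt_pos, chainEnergy]

theorem objective_zero (hn : 0 < n) :
    objective (chainFun J lam (n * σ) (σ * (1 - q)) (n * (lam + σ * (1 - q)))) 0 = 0 := by
  rw [objective_chainFun _ _ _ _ _ hn]
  simp

/-- Every chain whose last coordinate is still zero contributes to the suboptimality. -/
theorem le_objective_sub (hn : 0 < n) (h : lam * q = σ * (1 - q) ^ 2) (hlam : 0 ≤ lam)
    (hσ : 0 ≤ σ) (hq : q ≤ 1) (w : E (N * (k + 1))) (G : Finset (Fin N))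
    (hG : ∀ B ∈ G, w (pos B (Fin.last k)) = 0) :
    G.card * (lam / 2 * (q ^ k) ^ 2) ≤
      objective (chainFun J lam (n * σ) (σ * (1 - q)) (n * (lam + σ * (1 - q)))) w -
        objective (chainFun J lam (n * σ) (σ * (1 - q)) (n * (lam + σ * (1 - q))))
          (chainOpt N k q) := by
  rw [objective_chainOpt J hn h, objective_eq J hn h, sub_neg_eq_add, sub_add_cancel,
    ← nsmul_eq_mul, ← Finset.sum_const]
  refine (Finset.sum_le_sum fun B hB => ?_).trans
    (Finset.sum_le_sum_of_subset_of_nonneg (Finset.subset_univ G) fun B _ _ => ?_)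
  · have := le_chainEnergy hlam hσ hq
      (fun l : Fin (k + 1) => w (pos B l) - q ^ (l : ℕ)) (Fin.last k)
    simpa [hG B hB] using this
  · exact le_trans (by positivity) (le_chainEnergy hlam hσ hq _ 0)

end Gap

/-! ### The lower bound in terms of the chain length -/

/-- The decay ratio `q` of the optimum of a chain, where `y² = 4 σ / lam`. Explicitly,
`q = exp (-2 arsinh (1 / y))`. -/
theorem exists_ratio {y : ℝ} (hy : 0 < y) : ∃ q : ℝ, 0 < q ∧ q < 1 ∧
    4 * q = y ^ 2 * (1 - q) ^ 2 ∧ 1 ≤ (1 + y) * (1 - q) ∧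
    ∀ k : ℕ, Real.exp (-(4 * k / y)) ≤ (q ^ k) ^ 2 := by
  set a := Real.arsinh (1 / y) with ha
  have hsinh : Real.sinh a = 1 / y := Real.sinh_arsinh _
  have ha0 : 0 < a := Real.arsinh_pos_iff.2 (by positivity)
  have hay : a ≤ 1 / y := by rw [← hsinh]; exact Real.self_le_sinh_iff.2 ha0.le
  set s := Real.exp (-a) with hs
  have hs0 : 0 < s := Real.exp_pos _
  have hs1 : s < 1 := Real.exp_lt_one_iff.2 (by linarith)
  have h1 : y * (1 - s ^ 2) = 2 * s := by
    have h2 : Real.exp a * s = 1 := by rw [hs, ← Real.exp_add]; simp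
    rw [Real.sinh_eq, ← hs] at hsinh
    have h3 : y * (Real.exp a - s) = 2 := by field_simp at hsinh; linarith
    linear_combination s * h3 - y * h2
  refine ⟨s ^ 2, by positivity, by nlinarith, ?_, by nlinarith, fun k => ?_⟩
  · linear_combination (-(y * (1 - s ^ 2)) - 2 * s) * h1
  · rw [← pow_mul, ← pow_mul, hs, ← Real.exp_nat_mul, Real.exp_le_exp]
    have : 4 * (k : ℝ) * a ≤ 4 * k * (1 / y) := by gcongr
    push_cast
    have e : 4 * (k : ℝ) / y = 4 * k * (1 / y) := by ring
    linarith

/-- The lower bound for the hard instance with chains of length `k + 1`, one chain for each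
sequence of labels: within `n (k + 1) / 64` queries, a sixteenth of the chains is not passed,
regardless of the queried indices. -/
theorem ae_lt_of_objective_sub_le {n : ℕ} (hn : 1 < n) (k : ℕ) {lam σ q ε : ℝ} (hlam : 0 < lam)
    (hσ : 0 ≤ σ) (hq : q < 1) (h : lam * q = σ * (1 - q) ^ 2)
    (hε : 16 * ε < (1 - q) * (q ^ k) ^ 2)
    {Ω : Type*} [MeasurableSpace Ω] (P : MeasureTheory.Measure Ω)
    (alg : Algorithm Ω n (n ^ (k + 1) * (k + 1))) {f : Fin n → E (n ^ (k + 1) * (k + 1)) → ℝ}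
    (hf : f = chainFun (fun B => finFunctionFinEquiv.symm B) lam (n * σ) (σ * (1 - q))
      (n * (lam + σ * (1 - q))))
    (hfinst : IsInstance (lam + 4 * (n * σ)) lam f)
    (halg : LinearAlgebraic P (lam + 4 * (n * σ)) lam alg) :
    ∀ᵐ ω ∂P, ∀ T : ℕ, 1 ≤ T →
      objective f (point alg f ω (T - 1)) - objective f (chainOpt (n ^ (k + 1)) k q) ≤
        ε * (objective f 0 - objective f (chainOpt (n ^ (k + 1)) k q)) →
      n * (k + 1) < 64 * T := by
  have hn0 : 0 < n := by omega
  filter_upwards [halg f hfinst] with ω hω T hT hgap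
  by_contra! hcon
  set i := index alg f ω with hi
  have hcard := card_le_of_passTime hn0 i (T := T - 1) (K := k + 1) (by omega) (by omega)
  set G := (Finset.univ.filter fun j : Fin (k + 1) → Fin n =>
    T - 1 < passTime (window i) (T - 1) j (k + 1)).map finFunctionFinEquiv.toEmbedding with hG
  rw [← Finset.card_map finFunctionFinEquiv.toEmbedding, ← hG] at hcard
  have hzero : ∀ B ∈ G, point alg f ω (T - 1) (pos B (Fin.last k)) = 0 := by
    intro B hB
    obtain ⟨j, hj, rfl⟩ := Finset.mem_map.1 hB
    have hj' := (Finset.mem_filter.1 hj).2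
    rw [hf] at hω
    rw [hf]
    refine apply_eq_zero_of_mem_permitted _ _ _ _ _ hn (T - 1) hω (T - 1) _ (hω (T - 1)) _ _ ?_
    simpa using hj'.le
  have hle := le_objective_sub (fun B => finFunctionFinEquiv.symm B) hn0 h hlam.le hσ hq.le
    (point alg f ω (T - 1)) G hzero
  rw [← hf] at hle
  have hopt := objective_chainOpt (N := n ^ (k + 1)) (k := k)
    (fun B => finFunctionFinEquiv.symm B) hn0 h
  have h0 := objective_zero (N := n ^ (k + 1)) (k := k) (lam := lam) (σ := σ) (q := q)
    (fun B => finFunctionFinEquiv.symm B) hn0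
  rw [← hf] at hopt h0
  rw [h0, hopt, zero_sub, neg_neg] at hgap
  rw [hopt] at hle
  push_cast at hle hgap
  have hN : (0 : ℝ) < (n : ℝ) ^ (k + 1) := by positivity
  have hb : 0 < lam + σ * (1 - q) := by nlinarith [mul_nonneg hσ (sub_nonneg.2 hq.le)]
  have hlb : lam = (1 - q) * (lam + σ * (1 - q)) := by linear_combination h
  have h2 : (n : ℝ) ^ (k + 1) / 16 * (lam / 2 * (q ^ k) ^ 2) ≤
      ε * ((n : ℝ) ^ (k + 1) * ((lam + σ * (1 - q)) / 2)) := by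
    refine le_trans ?_ (hle.trans hgap)
    gcongr
    linarith
  have h3 : (n : ℝ) ^ (k + 1) * (lam + σ * (1 - q)) * ((1 - q) * (q ^ k) ^ 2) ≤
      (n : ℝ) ^ (k + 1) * (lam + σ * (1 - q)) * (16 * ε) := by
    have e : (n : ℝ) ^ (k + 1) * (lam + σ * (1 - q)) * ((1 - q) * (q ^ k) ^ 2) =
        (n : ℝ) ^ (k + 1) * lam * (q ^ k) ^ 2 := by
      linear_combination -((n : ℝ) ^ (k + 1) * (q ^ k) ^ 2) * hlb
    rw [e]
    linarith
  have h4 := le_of_mul_le_mul_left h3 (by positivity)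
  linarith

/-! ### The choice of the chain length -/

section Numeric
variable {n : ℕ} {mu lam ε y : ℝ}

theorem rpow_mul_sqrt_mul_le (hlam : 0 < lam) (hmu : lam < mu) (hy : 0 < y)
    (hyn : (n : ℝ) * y ^ 2 = mu / lam - 1) :
    (lam / mu) ^ (3 / 2 : ℝ) * √n * y ≤ lam / mu := by
  have hmu0 : 0 < mu := hlam.trans hmu
  have hr : 0 < lam / mu := by positivity
  have e : (lam / mu) ^ (3 / 2 : ℝ) = lam / mu * √(lam / mu) := by
    rw [show (3 / 2 : ℝ) = 1 + 1 / 2 by norm_num, Real.rpow_add hr, Real.rpow_one,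
      Real.sqrt_eq_rpow]
  have h1 : √(lam / mu) * √n * y ≤ 1 := by
    rw [← Real.sqrt_mul hr.le, ← Real.sqrt_sq hy.le, ← Real.sqrt_mul (by positivity),
      Real.sqrt_le_one, mul_assoc, hyn, mul_sub, mul_one]
    have : lam / mu * (mu / lam) = 1 := by field_simp
    linarith
  calc _ = lam / mu * (√(lam / mu) * √n * y) := by rw [e]; ring
    _ ≤ lam / mu * 1 := by gcongr
    _ = _ := mul_one _

theorem sqrt_mul_eq (hy : 0 < y) (hyn : (n : ℝ) * y ^ 2 = mu / lam - 1) :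
    √(n * (mu / lam - 1)) = n * y := by
  rw [← hyn, show (n : ℝ) * (n * y ^ 2) = (n * y) ^ 2 by ring]
  exact Real.sqrt_sq (by positivity)

/-- For `16 ε (1 + y) < 1`, the bound is of the order of `n` times the chain length. -/
theorem bound_le_of_pos (hn : 1 < n) (hlam : 0 < lam) (hmu : lam < mu) (hε : 0 < ε) (hy : 0 < y)
    (hyn : (n : ℝ) * y ^ 2 = mu / lam - 1) {K : ℝ} (hK : 1 ≤ K)
    (hyK : y * Real.log (1 / (16 * ε * (1 + y))) / 4 ≤ K) :
    1 / 4096 * (n + √(n * (mu / lam - 1)) * Real.log ((lam / mu) ^ (3 / 2 : ℝ) * √n / ε)) ≤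
      n * K / 64 := by
  have hn0 : (1 : ℝ) < n := by exact_mod_cast hn
  have hmu0 : 0 < mu := hlam.trans hmu
  set Q := (lam / mu) ^ (3 / 2 : ℝ) * √n with hQ
  have hQ0 : 0 < Q := by positivity
  have hQy : Q * y ≤ lam / mu := rpow_mul_sqrt_mul_le hlam hmu hy hyn
  have hlog : Real.log (Q / ε) =
      Real.log (1 / (16 * ε * (1 + y))) + Real.log (16 * (1 + y) * Q) := by
    rw [← Real.log_mul (by positivity) (by positivity)]
    congr 1
    field_simp
  have h1 : y * (16 * (1 + y) * Q) ≤ 32 := by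
    have hκ : 1 + y ≤ 2 * (mu / lam) := by nlinarith [sq_nonneg (y - 1)]
    calc y * (16 * (1 + y) * Q) = 16 * (1 + y) * (Q * y) := by ring
      _ ≤ 16 * (2 * (mu / lam)) * (lam / mu) := by gcongr
      _ = 32 := by field_simp; norm_num
  have h2 : y * Real.log (16 * (1 + y) * Q) ≤ 32 := by
    refine le_trans ?_ h1
    gcongr
    exact Real.log_le_self (by positivity)
  have h3 : y * Real.log (Q / ε) ≤ 4 * K + 32 := by
    rw [hlog, mul_add]
    linarith
  rw [sqrt_mul_eq hy hyn, mul_assoc]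
  have h4 : (n : ℝ) * (y * Real.log (Q / ε)) ≤ n * (4 * K + 32) := by gcongr
  nlinarith

/-- For `1 ≤ 16 ε (1 + y)` the logarithm in the bound is so negative that the bound is void. -/
theorem bound_nonpos (hn : 1 < n) (hlam : 0 < lam) (hmu : lam < mu) (hε : 0 < ε)
    (hε' : ε < 1 / 1024) (hy : 0 < y) (hyn : (n : ℝ) * y ^ 2 = mu / lam - 1)
    (hεy : 1 ≤ 16 * ε * (1 + y)) :
    1 / 4096 * (n + √(n * (mu / lam - 1)) * Real.log ((lam / mu) ^ (3 / 2 : ℝ) * √n / ε)) ≤ 0 := by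
  have hn0 : (1 : ℝ) < n := by exact_mod_cast hn
  have hmu0 : 0 < mu := hlam.trans hmu
  set Q := (lam / mu) ^ (3 / 2 : ℝ) * √n with hQ
  have hQ0 : 0 < Q := by positivity
  have hQy : Q * y ≤ lam / mu := rpow_mul_sqrt_mul_le hlam hmu hy hyn
  have h1 : 1 / 32 ≤ ε * y := by nlinarith
  have h2 : 32 ≤ y := by nlinarith
  have h3 : Q * y * y ^ 2 ≤ 1 := by
    have : y ^ 2 ≤ mu / lam := by nlinarith [sq_nonneg y]
    calc Q * y * y ^ 2 ≤ lam / mu * (mu / lam) := by gcongr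
      _ = 1 := by field_simp
  have h4 : Q ≤ 1 / 3 * ε := by
    have : Q * y ^ 3 ≤ 1 / 3 * ε * y ^ 3 := by
      have : 1 / 32 * 32 ^ 2 ≤ ε * y * y ^ 2 := by gcongr
      nlinarith
    exact le_of_mul_le_mul_right this (by positivity)
  have h5 : Real.log (Q / ε) ≤ -1 := by
    rw [Real.log_le_iff_le_exp (by positivity), Real.exp_neg]
    have : Q / ε ≤ 1 / 3 := by rw [div_le_iff₀ hε]; exact h4
    refine this.trans ?_
    rw [one_div]
    have := Real.exp_one_lt_d9
    gcongr
    linarith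
  rw [sqrt_mul_eq hy hyn]
  have h6 : (n : ℝ) * y * Real.log (Q / ε) ≤ n * y * (-1) := by gcongr
  nlinarith

theorem dimension_le (hn : 1 < n) {k : ℕ} {x : ℝ} (hk : (k : ℝ) ≤ x) :
    ((n ^ (k + 1) * (k + 1) : ℕ) : ℝ) ≤ (n : ℝ) ^ (2 * (1 + x)) := by
  have h1 : k + 1 ≤ n ^ (k + 1) := Nat.lt_two_pow_self.le.trans (Nat.pow_le_pow_left hn _)
  have hn0 : (1 : ℝ) ≤ n := by exact_mod_cast hn.le
  calc ((n ^ (k + 1) * (k + 1) : ℕ) : ℝ) ≤ ((n ^ (k + 1) * n ^ (k + 1) : ℕ) : ℝ) := by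
        exact_mod_cast Nat.mul_le_mul_left _ h1
    _ = (n : ℝ) ^ (2 * (1 + k : ℝ)) := by
        rw [← pow_add, Nat.cast_pow, ← Real.rpow_natCast]
        congr 1
        push_cast
        ring
    _ ≤ _ := Real.rpow_le_rpow_of_exponent_le hn0 (by linarith)

/-- The choice of the chain length `k + 1`, for `y² = (mu / lam - 1) / n`: unless the bound to be
proved is void, the chains are short enough for the accuracy `ε` to require passing them, and long
enough for `n (k + 1) / 64` to exceed the bound. -/
theorem exists_length (hn : 1 < n) (hlam : 0 < lam) (hmu : lam < mu) (hε : 0 < ε)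
    (hε' : ε < 1 / 1024) (hy : 0 < y) (hyn : (n : ℝ) * y ^ 2 = mu / lam - 1) :
    ∃ k : ℕ, (k : ℝ) ≤ √(mu / (lam * n)) * Real.log (n / ε) ∧
      (1 / 4096 * (n + √(n * (mu / lam - 1)) * Real.log ((lam / mu) ^ (3 / 2 : ℝ) * √n / ε)) ≤ 0 ∨
      (16 * ε * (1 + y) < Real.exp (-(4 * k / y)) ∧
        1 / 4096 * (n + √(n * (mu / lam - 1)) *
          Real.log ((lam / mu) ^ (3 / 2 : ℝ) * √n / ε)) ≤ n * (k + 1) / 64)) := by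
  have hn0 : (1 : ℝ) < n := by exact_mod_cast hn
  have hlog : 0 ≤ Real.log (n / ε) := by
    apply Real.log_nonneg
    rw [le_div_iff₀ hε]
    linarith
  rcases le_or_gt 1 (16 * ε * (1 + y)) with h | h
  · exact ⟨0, by simp only [Nat.cast_zero]; positivity,
      Or.inl (bound_nonpos hn hlam hmu hε hε' hy hyn h)⟩
  have hpos : 0 < 16 * ε * (1 + y) := by positivity
  set Λ := Real.log (1 / (16 * ε * (1 + y))) with hΛ
  have hΛ0 : 0 < Λ := Real.log_pos (by rw [lt_div_iff₀ hpos]; linarith)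
  obtain ⟨k, hk⟩ : ∃ k, ⌈y * Λ / 4⌉₊ = k + 1 :=
    Nat.exists_eq_succ_of_ne_zero (Nat.ceil_pos.2 (by positivity)).ne'
  have hk1 : (k : ℝ) < y * Λ / 4 := Nat.lt_ceil.1 (by omega)
  have hk2 : y * Λ / 4 ≤ k + 1 := by
    have := Nat.le_ceil (y * Λ / 4)
    rw [hk] at this
    exact_mod_cast this
  refine ⟨k, ?_, Or.inr ⟨?_, bound_le_of_pos hn hlam hmu hε hy hyn ?_ hk2⟩⟩
  · have h1 : y ≤ √(mu / (lam * n)) := by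
      apply Real.le_sqrt_of_sq_le
      rw [← div_div, le_div_iff₀ (by linarith)]
      linarith
    have h2 : Λ ≤ Real.log (n / ε) := by
      apply Real.log_le_log (by positivity)
      rw [div_le_div_iff₀ hpos hε]
      nlinarith
    have h3 : y * Λ ≤ √(mu / (lam * n)) * Real.log (n / ε) := by gcongr
    have : 0 < y * Λ := by positivity
    linarith
  · have h1 : 4 * k / y < Λ := by
      rw [div_lt_iff₀ hy]
      linarith
    rw [← Real.log_lt_iff_lt_exp hpos]
    have h2 : Λ = -Real.log (16 * ε * (1 + y)) := by rw [hΛ, one_div, Real.log_inv]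
    linarith
  · have : (0 : ℝ) ≤ k := Nat.cast_nonneg k
    linarith

end Numeric

end SecondOrder

theorem theorem3 :
    -- universal constants
    ∃ c c₀ C : ℝ, 0 < c ∧ 0 < c₀ ∧ 0 < C ∧
      ∀ (n : ℕ) (mu lam ε : ℝ), 1 < n → 0 < lam → lam < mu → 0 < ε → ε < c →
        -- a dimension that depends only on `n`, `mu`, `lam` and `ε`
        ∃ d : ℕ,
          (d : ℝ) ≤ (n : ℝ) ^ (C * (1 + √(mu / (lam * n)) * Real.log (n / ε))) ∧
          ∀ (Ω : Type*) (_ : MeasurableSpace Ω) (P : MeasureTheory.Measure Ω)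
            (_ : MeasureTheory.IsProbabilityMeasure P) (alg : SecondOrder.Algorithm Ω n d),
            SecondOrder.LinearAlgebraic P mu lam alg →
            ∃ f : Fin n → SecondOrder.E d → ℝ, SecondOrder.IsInstance mu lam f ∧
              ∃ wstar : SecondOrder.E d,
                (∀ w, SecondOrder.objective f wstar ≤ SecondOrder.objective f w) ∧
                -- the `T`-th query is query number `T - 1` when one counts from zero
                ∀ᵐ ω ∂P, ∀ T : ℕ, 1 ≤ T →
                  SecondOrder.objective f (SecondOrder.point alg f ω (T - 1))
                      - SecondOrder.objective f wstar
                    ≤ ε * (SecondOrder.objective f 0 - SecondOrder.objective f wstar) →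
                  c₀ * (n + √(n * (mu / lam - 1))
                      * Real.log ((lam / mu) ^ (3 / 2 : ℝ) * √n / ε)) ≤ T := by
  refine ⟨1 / 1024, 1 / 4096, 2, by norm_num, by norm_num, by norm_num, ?_⟩
  intro n mu lam ε hn hlam hmu hε hε'
  have hn0 : (1 : ℝ) < n := by exact_mod_cast hn
  have hκ : 0 < mu / lam - 1 := by rw [sub_pos, one_lt_div hlam]; exact hmu
  set y := √((mu / lam - 1) / n) with hydef
  have hy : 0 < y := Real.sqrt_pos.2 (by positivity)
  have hyn : (n : ℝ) * y ^ 2 = mu / lam - 1 := by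
    rw [hydef, Real.sq_sqrt (by positivity)]
    field_simp
  obtain ⟨q, hq0, hq1, hq, hqy, hqk⟩ := SecondOrder.exists_ratio hy
  obtain ⟨k, hk, hbound⟩ := SecondOrder.exists_length hn hlam hmu hε hε' hy hyn
  -- the coefficient of the chain edges in the objective
  obtain ⟨σ, hσ⟩ : ∃ σ, σ = (mu - lam) / (4 * n) := ⟨_, rfl⟩
  have hσ0 : 0 ≤ σ := by rw [hσ]; have := sub_pos.2 hmu; positivity
  have hmueq : lam + 4 * (n * σ) = mu := by rw [hσ]; field_simp; ring
  have hσy : 4 * σ = lam * y ^ 2 := by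
    have h1 : (n : ℝ) * (4 * σ) = n * (lam * y ^ 2) := by
      rw [mul_left_comm (n : ℝ) lam, hyn, mul_sub, mul_div_cancel₀ _ hlam.ne']
      linarith
    exact mul_left_cancel₀ (by positivity) h1
  have hqσ : lam * q = σ * (1 - q) ^ 2 := by
    linear_combination lam / 4 * hq - (1 - q) ^ 2 / 4 * hσy
  refine ⟨n ^ (k + 1) * (k + 1), SecondOrder.dimension_le hn hk, ?_⟩
  intro Ω _ P _ alg halg
  obtain ⟨f, hf⟩ : ∃ f, f = SecondOrder.chainFun (N := n ^ (k + 1)) (k := k)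
    (fun B => finFunctionFinEquiv.symm B) lam (n * σ) (σ * (1 - q)) (n * (lam + σ * (1 - q))) :=
    ⟨_, rfl⟩
  have hinst : SecondOrder.IsInstance (lam + 4 * (n * σ)) lam f := by
    rw [hf]
    apply SecondOrder.chainFun_isInstance
    · positivity
    · exact mul_nonneg hσ0 (by linarith)
    · nlinarith
  refine ⟨f, hmueq ▸ hinst, SecondOrder.chainOpt (n ^ (k + 1)) k q, fun w => ?_, ?_⟩
  · have := SecondOrder.le_objective_sub (k := k) (fun B => finFunctionFinEquiv.symm B)
      (zero_lt_one.trans hn) hqσ hlam.le hσ0 hq1.le w ∅ (by simp)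
    rw [← hf] at this
    simpa using this
  · rcases hbound with hbound | ⟨hεk, hbound⟩
    · exact Filter.Eventually.of_forall fun ω T _ _ => hbound.trans (Nat.cast_nonneg T)
    · have hgap : 16 * ε < (1 - q) * (q ^ k) ^ 2 := by
        have h1 := hεk.trans_le (hqk k)
        have h2 : 16 * ε ≤ 16 * ε * ((1 + y) * (1 - q)) := le_mul_of_one_le_right (by positivity) hqy
        nlinarith
      filter_upwards [SecondOrder.ae_lt_of_objective_sub_le hn k hlam hσ0 hq1 hqσ hgap P alg hf
        hinst (hmueq.symm ▸ halg)] with ω hω T hT hT'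
      have h1 : ((n * (k + 1) : ℕ) : ℝ) < ((64 * T : ℕ) : ℝ) := by exact_mod_cast hω T hT hT'
      push_cast at h1
      linarith
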